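/- **Conventions.** Chain complexes $M$ of (not necessarily abelian) groups are indexed by $\mathbb Z$, with differentials $\delta_i : M_i \to M_{i-1}$; $M$ is *proper* if the image of every $\delta_i$ is a normal subgroup, and $pch(Grp)$ is the category of proper chain complexes. A sequence $0\to A\xrightarrow{k} B\xrightarrow{p} C\to 0$ is short exact if $k$ is a kernel of $p$ and $p$ is a cokernel of $k$; a short exact sequence in $pch(Grp)$ is a short exact sequence of chain complexes all of whose terms are proper. A torsion theory is a pair $(\mathcal T,\mathcal F)$ of full replete subcategories such that every morphism from an object of $\mathcal T$ to an object of $\mathcal F$ is zero and every object $X$ is the middle term of a short exact sequence $0\to T\to X\to F\to 0$ with $T\in\mathcal T$, $F\in\mathcal F$ (its *torsion sequence*, unique up to isomorphism). For $m\in\mathbb Z$ let $\mathcal{EP}_m$ be the class of proper complexes $M$ with $\delta_m$ a normal epimorphism and $M_i=0$ for $i<m-1$, let $pch(Grp)_{m-1\ge}$ be the class of proper complexes with $M_i=0$ for $i>m-1$, and let $\mathcal{COK}_m=(\mathcal{EP}_m,pch(Grp)_{m-1\geq})$. For a simplicial group $X$, the Moore complex $N(X)$ is $N(X)_0=X_0$,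 $N(X)_k=\bigcap_{i=0}^{k-1}\ker(d_i:X_k\to X_{k-1})$ for $k\ge 1$ and $N(X)_k=0$ for $k<0$, with $\delta_k$ the restriction of $d_k$ for $k\geq 1$. For $n\ge 0$ let $\mathcal M_{n\ge}$ be the class of simplicial groups $X$ with $N(X)_i=0$ for all $i>n$. With $M=N(X)$, let $\mathrm{Cot}_n(X)$ be the simplicial group obtained from the semidirect decomposition of the groups $X_j$ into copies of the $M_k$ by deleting the copies of $M_k$ for $k>n$ and replacing $M_n$ by $M_n/\delta_{n+1}(M_{n+1})$; that is, $\mathrm{Cot}_n(X)_j$ is the quotient of $X_j$ by the normal subgroup generated by all $s_\sigma(M_k)$, for surjections $\sigma:[j]\to[k]$ with $k>n$, and all $s_\sigma(\delta_{n+1}(M_{n+1}))$, for surjections $\sigma:[j]\to[n]$. Let $\eta_X:X\to \mathrm{Cot}_n(X)$ be the projection, $\mathrm{Ker}(\mathrm{Cot}_n)=\{X\mid \mathrm{Cot}_n(X)\cong 0\}$, and $\mu_{n\ge}=(\mathrm{Ker}(\mathrm{Cot}_n),\mathcal M_{n\ge})$. **Theorem.** Let $n\ge 0$. The pair $\mu_{n\ge}$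 is a torsion theory in simplicial groups, and $\mathcal{COK}_{n+1}$ is a torsion theory in $pch(Grp)$. Let $X$ be a simplicial group with Moore complex $M=N(X)$. Then $M$ is proper, the sequence $$0\to\ker(\eta_X)\to X\xrightarrow{\eta_X}\mathrm{Cot}_n(X)\to 0$$ is the torsion sequence of $X$ for $\mu_{n\ge}$, and $N$ maps it to the torsion sequence of $M$ for $\mathcal{COK}_{n+1}$: its image under $N$ is a torsion sequence for $\mathcal{COK}_{n+1}$, and it is isomorphic, by an isomorphism that is the identity on $M$, to the torsion sequence $0\to T\to M\to F\to 0$ in which $$T=(\cdots\to M_{n+2}\to M_{n+1}\twoheadrightarrow\delta_{n+1}(M_{n+1})\to 0\to\cdots),\qquad F=(\cdots\to 0\to M_n/\delta_{n+1}(M_{n+1})\to M_{n-1}\to M_{n-2}\to\cdots).$$ Consequently $N$ maps $\mathrm{Ker}(\mathrm{Cot}_n)$ into $\mathcal{EP}_{n+1}$ and $\mathcal M_{n\ge}$ into $pch(Grp)_{n\ge}$. -/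

import Mathlib

open CategoryTheory CategoryTheory.Limits Opposite

universe u

noncomputable section

/-! ### Groups and simplicial groups as pointed categories -/

/-- The zero morphisms of the category of groups are the trivial homomorphisms. -/
instance GrpCat.instHasZeroMorphismsTrivial : HasZeroMorphisms GrpCat.{u} where
  zero G H := ⟨GrpCat.ofHom 1⟩
  comp_zero _ _ := rfl
  zero_comp G H K f := by
    ext x
    exact map_one f.hom

/-- Zero morphisms of simplicial groups are the degreewise trivial maps. -/
instance SimpGrp.instHasZeroMorphisms : HasZeroMorphisms (SimplicialObject GrpCat.{u}) :=
  inferInstanceAs (HasZeroMorphisms (SimplexCategoryᵒᵖ ⥤ GrpCat.{u}))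

instance SimpGrp.instHasKernels : HasKernels (SimplicialObject GrpCat.{u}) :=
  inferInstanceAs (HasKernels (SimplexCategoryᵒᵖ ⥤ GrpCat.{u}))

theorem GrpCat.zero_apply' {G H : GrpCat.{u}} (x : G) : (0 : G ⟶ H) x = 1 := rfl

/-! ### Short exact sequences and torsion theories -/

section Torsion

variable {C : Type*} [Category C] [HasZeroMorphisms C]

/-- `0 ⟶ X₁ ⟶ X₂ ⟶ X₃ ⟶ 0` is short exact: the first map is a kernel of the second one, and the
second map is a cokernel of the first one. -/
structure IsShortExactSeq (S : ShortComplex C) : Prop where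
  isKernel : Nonempty (IsLimit (KernelFork.ofι S.f S.zero))
  isCokernel : Nonempty (IsColimit (CokernelCofork.ofπ S.g S.zero))

/-- A short exact sequence whose subobject lies in `T` and whose quotient lies in `F`. -/
structure IsTorsionSeq (T F : ObjectProperty C) (S : ShortComplex C) : Prop where
  shortExact : IsShortExactSeq S
  torsion : T S.X₁
  torsionFree : F S.X₃

/-- `(T, F)` is a torsion theory in the full subcategory of `C` on the objects satisfying `P`, where
short exact sequences in that subcategory are those of `C` all of whose objects satisfy `P`.
For `P = ⊤` this is a torsion theory in `C`. -/
structure IsTorsionTheory (P T F : ObjectProperty C) : Prop where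
  torsion_le : T ≤ P
  torsionFree_le : F ≤ P
  replete_torsion : T.IsClosedUnderIsomorphisms
  replete_torsionFree : F.IsClosedUnderIsomorphisms
  hom_eq_zero : ∀ ⦃A B : C⦄, T A → F B → ∀ f : A ⟶ B, f = 0
  exists_seq : ∀ X : C, P X → ∃ S : ShortComplex C, S.X₂ = X ∧ IsTorsionSeq T F S

end Torsion

/-! ### Chain complexes of groups -/

namespace GrpChain

/-- Proper chain complexes: the image of every differential is a normal subgroup. -/
def proper : ObjectProperty (ChainComplex GrpCat.{u} ℤ) :=
  fun M => ∀ i j : ℤ, (M.d i j).hom.range.Normal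

/-- The proper chain complexes `M` with `M_i = 0` for `i > n`. -/
def properLE (n : ℤ) : ObjectProperty (ChainComplex GrpCat.{u} ℤ) :=
  fun M => proper M ∧ ∀ i : ℤ, n < i → IsZero (M.X i)

/-- `EP_m`: the proper chain complexes `M` such that `δ_m : M_m ⟶ M_{m-1}` is a normal epimorphism
and `M_i = 0` for `i < m - 1`. -/
def EP (m : ℤ) : ObjectProperty (ChainComplex GrpCat.{u} ℤ) :=
  fun M => proper M ∧ Nonempty (NormalEpi (M.d m (m - 1))) ∧ ∀ i : ℤ, i < m - 1 → IsZero (M.X i)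

variable (M : ChainComplex GrpCat.{u} ℤ) (m : ℤ)

theorem d_d_apply (i j k : ℤ) (x : M.X i) : M.d j k (M.d i j x) = 1 :=
  ConcreteCategory.congr_hom (M.d_comp_d i j k) x

/-- The subgroup `M_i` for `i ≥ m`, `δ_m(M_m)` for `i = m - 1`, and the trivial subgroup for
`i < m - 1` (in which case `M.d m i` is trivial). -/
def cokSubgroup (i : ℤ) : Subgroup (M.X i) :=
  if m ≤ i then ⊤ else (M.d m i).hom.range

theorem cokSubgroup_d (i j : ℤ) (x : M.X i) (hx : x ∈ cokSubgroup M m i) :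
    M.d i j x ∈ cokSubgroup M m j := by
  unfold cokSubgroup at hx ⊢
  split_ifs with hj
  · trivial
  · split_ifs at hx with hi
    · by_cases hij : j + 1 = i
      · obtain rfl : m = i := by omega
        exact ⟨x, rfl⟩
      · rw [M.shape i j hij]
        exact one_mem _
    · obtain ⟨y, rfl⟩ := hx
      have h := d_d_apply M m i j y
      change (M.d i j) ((M.d m i) y) ∈ _
      rw [h]
      exact one_mem _

/-- The subcomplex `… ⟶ M_{m+1} ⟶ M_m ⟶ δ_m(M_m) ⟶ 0 ⟶ …` of `M`. -/
def cokSub : ChainComplex GrpCat.{u} ℤ where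
  X i := GrpCat.of (cokSubgroup M m i)
  d i j := GrpCat.ofHom <| ((M.d i j).hom.comp (cokSubgroup M m i).subtype).codRestrict
    (cokSubgroup M m j) fun x => cokSubgroup_d M m i j x.1 x.2
  shape i j hij := by
    ext x
    change M.d i j x.1 = 1
    rw [M.shape i j hij]
    rfl
  d_comp_d' i j k _ _ := by
    ext x
    exact d_d_apply M i j k x.1

/-- The inclusion of the subcomplex `cokSub M m` in `M`. -/
def cokι : cokSub M m ⟶ M where
  f i := GrpCat.ofHom (cokSubgroup M m i).subtype
  comm' _ _ _ := rfl

/-- The cotruncation `Cot_{m-1}(M) = (… ⟶ 0 ⟶ Cok(δ_m) ⟶ M_{m-2} ⟶ M_{m-3} ⟶ …)`, written as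
the quotient of `M` by the degreewise normal closure of the subcomplex `cokSub M m`. -/
def cot : ChainComplex GrpCat.{u} ℤ where
  X i := GrpCat.of (M.X i ⧸ Subgroup.normalClosure (cokSubgroup M m i : Set (M.X i)))
  d i j := GrpCat.ofHom <| QuotientGroup.map _ _ (M.d i j).hom <|
    Subgroup.normalClosure_le_normal fun x hx =>
      Subgroup.subset_normalClosure (cokSubgroup_d M m i j x hx)
  shape i j hij := by
    ext x
    change QuotientGroup.mk (s := Subgroup.normalClosure (cokSubgroup M m j : Set (M.X j)))
      (M.d i j x) = 1
    rw [M.shape i j hij]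
    rfl
  d_comp_d' i j k _ _ := by
    ext x
    change QuotientGroup.mk (s := Subgroup.normalClosure (cokSubgroup M m k : Set (M.X k)))
      (M.d j k (M.d i j x)) = 1
    rw [d_d_apply]
    rfl

/-- The projection of `M` onto its cotruncation. -/
def cokπ : M ⟶ cot M m where
  f _ := GrpCat.ofHom (QuotientGroup.mk' _)
  comm' _ _ _ := rfl

/-- The sequence `0 ⟶ cokSub M m ⟶ M ⟶ Cot_{m-1}(M) ⟶ 0` of the torsion theory `COK_m`. -/
def cokSeq : ShortComplex (ChainComplex GrpCat.{u} ℤ) :=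
  ShortComplex.mk (cokι M m) (cokπ M m) <| by
    ext i x
    exact (QuotientGroup.eq_one_iff _).2 (Subgroup.subset_normalClosure x.2)

end GrpChain

/-! ### The Moore normalization -/

namespace SimpGrp

section Moore

variable (X : SimplicialObject GrpCat.{u})

/-- The subgroup `N(X)_n`, the intersection of the kernels of `d_0, …, d_{n-1}` on `X_n`. -/
def moore : ∀ n : ℕ, Subgroup (X.obj (op (.mk n)))
  | 0 => ⊤
  | n + 1 => ⨅ i : Fin (n + 1), (X.δ i.castSucc).hom.ker

theorem mem_moore_succ {n : ℕ} {x : X.obj (op (.mk (n + 1)))} :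
    x ∈ moore X (n + 1) ↔ ∀ i : Fin (n + 1), X.δ i.castSucc x = 1 := by
  simp only [moore, Subgroup.mem_iInf, MonoidHom.mem_ker]

/-- The last face of an element of the Moore complex is again in the Moore complex. -/
theorem δ_last_mem_moore {n : ℕ} {x : X.obj (op (.mk (n + 1)))} (hx : x ∈ moore X (n + 1)) :
    X.δ (Fin.last (n + 1)) x ∈ moore X n := by
  cases n with
  | zero => trivial
  | succ n =>
    rw [mem_moore_succ] at hx ⊢
    intro i
    have h := ConcreteCategory.congr_hom
      (X.δ_comp_δ (i := i.castSucc) (j := Fin.last (n + 1)) (Fin.le_last _)) x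
    simp only [ConcreteCategory.comp_apply, Fin.succ_last] at h
    rw [h, hx i.castSucc, map_one]

theorem δ_last_δ_last {n : ℕ} {x : X.obj (op (.mk (n + 2)))} (hx : x ∈ moore X (n + 2)) :
    X.δ (Fin.last (n + 1)) (X.δ (Fin.last (n + 2)) x) = 1 := by
  have h := ConcreteCategory.congr_hom
    (X.δ_comp_δ (i := Fin.last (n + 1)) (j := Fin.last (n + 1)) le_rfl) x
  simp only [ConcreteCategory.comp_apply, Fin.succ_last] at h
  rw [h, (mem_moore_succ X).1 hx (Fin.last (n + 1)), map_one]

/-- The differential `δ_{n+1} : N(X)_{n+1} ⟶ N(X)_n`, the restriction of `d_{n+1}`. -/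
def mooreδ (n : ℕ) : moore X (n + 1) →* moore X n :=
  ((X.δ (Fin.last (n + 1))).hom.comp (moore X (n + 1)).subtype).codRestrict _
    fun x => δ_last_mem_moore X x.2

/-- The groups of the Moore complex, zero in negative degrees. -/
def mooreX : ℤ → GrpCat.{u}
  | Int.ofNat n => GrpCat.of (moore X n)
  | Int.negSucc _ => GrpCat.of PUnit.{u + 1}

/-- The differentials of the Moore complex, zero outside of positive degrees. -/
def mooreD : ∀ i : ℤ, mooreX X (i + 1) ⟶ mooreX X i
  | Int.ofNat n => GrpCat.ofHom (mooreδ X n)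
  | Int.negSucc _ => 0

theorem mooreD_comp (i : ℤ) : mooreD X (i + 1) ≫ mooreD X i = 0 := by
  match i with
  | Int.ofNat n =>
    ext x
    exact Subtype.ext (δ_last_δ_last X x.2)
  | Int.negSucc n =>
    exact comp_zero

variable {X} {Y : SimplicialObject GrpCat.{u}} (f : X ⟶ Y)

theorem δ_naturality_apply {n : ℕ} (i : Fin (n + 2)) (x : X.obj (op (.mk (n + 1)))) :
    Y.δ i (f.app _ x) = f.app _ (X.δ i x) :=
  (ConcreteCategory.congr_hom (SimplicialObject.δ_naturality f i) x).symm

theorem map_mem_moore {n : ℕ} {x : X.obj (op (.mk n))} (hx : x ∈ moore X n) : f.app _ x ∈ moore Y n := by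
  cases n with
  | zero => trivial
  | succ n =>
    rw [mem_moore_succ] at hx ⊢
    intro i
    rw [δ_naturality_apply, hx i, map_one]

/-- The maps induced by a simplicial homomorphism on Moore complexes. -/
def mooreMap : ∀ i : ℤ, mooreX X i ⟶ mooreX Y i
  | Int.ofNat n => GrpCat.ofHom <|
      ((f.app (op (SimplexCategory.mk n))).hom.comp (moore X n).subtype).codRestrict _ fun x => map_mem_moore f x.2
  | Int.negSucc _ => 𝟙 _

theorem mooreMap_comm (i : ℤ) :
    mooreMap f (i + 1) ≫ mooreD Y i = mooreD X i ≫ mooreMap f i := by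
  match i with
  | Int.ofNat n =>
    ext x
    exact Subtype.ext (δ_naturality_apply f _ x.1)
  | Int.negSucc n =>
    ext x
    exact Subsingleton.elim (α := PUnit) _ _

end Moore

/-- The Moore normalization functor `N`. -/
def N : SimplicialObject GrpCat.{u} ⥤ ChainComplex GrpCat.{u} ℤ where
  obj X := ChainComplex.of (mooreX X) (mooreD X) (mooreD_comp X)
  map {X Y} f := ChainComplex.ofHom
    (X := ChainComplex.of (mooreX X) (mooreD X) (mooreD_comp X))
    (Y := ChainComplex.of (mooreX Y) (mooreD Y) (mooreD_comp Y))
    (mooreMap f) fun i => by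
      simpa only [ChainComplex.of_d] using mooreMap_comm f i
  map_id X := by
    ext i x
    match i with
    | Int.ofNat n => rfl
    | Int.negSucc n => rfl
  map_comp f g := by
    ext i x
    match i with
    | Int.ofNat n => rfl
    | Int.negSucc n => rfl

instance : (N.{u}).PreservesZeroMorphisms where
  map_zero X Y := by
    ext i x
    match i with
    | Int.ofNat n => rfl
    | Int.negSucc n => exact Subsingleton.elim (α := PUnit) _ _

/-! ### The cotruncation functor on simplicial groups -/

section Cot

variable (n : ℕ) (X : SimplicialObject GrpCat.{u})

/-- The part of the `k`-th term of the Moore complex `M` of `X` that the `n`-th cotruncation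
removes: all of `M_k` for `k > n`, the boundaries `δ_{n+1}(M_{n+1})` for `k = n`, and nothing for
`k < n`. -/
def killed (k : ℕ) : Subgroup (X.obj (op (.mk k))) :=
  if n < k then moore X k
  else if k = n then (moore X (k + 1)).map (X.δ (Fin.last (k + 1))).hom
  else ⊥

/-- The copies `s_σ(killed_k)`, over all surjections `σ : [j] ⟶ [k]`, of the removed parts in the
semidirect decomposition of `X_j`. -/
def cotGen (j : SimplexCategoryᵒᵖ) : Set (X.obj j) :=
  {y | ∃ (k : ℕ) (σ : j.unop ⟶ (SimplexCategory.mk k)) (x : X.obj (op (.mk k))), Epi σ ∧ x ∈ killed n X k ∧ X.map σ.op x = y}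

/-- The kernel of `X ⟶ Cot_n(X)` in degree `j`. -/
def cotKer (j : SimplexCategoryᵒᵖ) : Subgroup (X.obj j) :=
  Subgroup.normalClosure (cotGen n X j)

instance (j : SimplexCategoryᵒᵖ) : (cotKer n X j).Normal :=
  Subgroup.normalClosure_normal

variable {n X}

theorem killed_δ {k : ℕ} {x : X.obj (op (.mk (k + 1)))} (hx : x ∈ killed n X (k + 1)) (i : Fin (k + 2)) :
    X.δ i x ∈ killed n X k := by
  have key : x ∈ moore X (k + 1) := by
    unfold killed at hx
    split_ifs at hx with h1 h2
    · exact hx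
    · obtain ⟨y, hy, rfl⟩ := hx
      exact δ_last_mem_moore X hy
    · rw [Subgroup.mem_bot] at hx
      rw [hx]
      exact one_mem _
  induction i using Fin.lastCases with
  | cast i =>
    rw [(mem_moore_succ X).1 key i]
    exact one_mem _
  | last =>
    unfold killed at hx ⊢
    split_ifs with h1 h2
    · exact δ_last_mem_moore X key
    · exact ⟨x, key, rfl⟩
    · rw [if_neg (by omega)] at hx
      split_ifs at hx with h3
      · obtain ⟨y, hy, rfl⟩ := hx
        exact δ_last_δ_last X hy
      · rw [Subgroup.mem_bot] at hx ⊢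
        rw [hx, map_one]

theorem map_killed_mem_cotKer (k : ℕ) :
    ∀ (j : SimplexCategoryᵒᵖ) (θ : j.unop ⟶ (SimplexCategory.mk k)) (x : X.obj (op (.mk k))),
      x ∈ killed n X k → X.map θ.op x ∈ cotKer n X j := by
  induction k with
  | zero =>
    intro j θ x hx
    refine Subgroup.subset_normalClosure ⟨0, θ, x, ?_, hx, rfl⟩
    rw [SimplexCategory.epi_iff_surjective]
    intro b
    exact ⟨0, Subsingleton.elim (α := Fin 1) _ _⟩
  | succ k ih =>
    intro j θ x hx
    by_cases hθ : Function.Surjective θ.toOrderHom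
    · exact Subgroup.subset_normalClosure
        ⟨k + 1, θ, x, SimplexCategory.epi_iff_surjective.2 hθ, hx, rfl⟩
    · obtain ⟨i, θ', rfl⟩ := SimplexCategory.eq_comp_δ_of_not_surjective θ hθ
      have h := ih j θ' (X.δ i x) (killed_δ hx i)
      rw [op_comp, X.map_comp]
      exact h

theorem cotKer_map {i j : SimplexCategoryᵒᵖ} (θ : i ⟶ j) :
    cotKer n X i ≤ (cotKer n X j).comap (X.map θ).hom := by
  refine Subgroup.normalClosure_le_normal ?_
  rintro _ ⟨k, σ, x, -, hx, rfl⟩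
  have h := map_killed_mem_cotKer k j (θ.unop ≫ σ) x hx
  rw [op_comp, X.map_comp] at h
  exact h

theorem killed_app {Y : SimplicialObject GrpCat.{u}} (f : X ⟶ Y) {k : ℕ} {x : X.obj (op (.mk k))}
    (hx : x ∈ killed n X k) : f.app _ x ∈ killed n Y k := by
  unfold killed at hx ⊢
  split_ifs at hx ⊢ with h1 h2
  · exact map_mem_moore f hx
  · obtain ⟨y, hy, rfl⟩ := hx
    exact ⟨f.app _ y, map_mem_moore f hy, δ_naturality_apply f _ y⟩
  · rw [Subgroup.mem_bot] at hx ⊢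
    rw [hx, map_one]

theorem cotKer_app {Y : SimplicialObject GrpCat.{u}} (f : X ⟶ Y) (j : SimplexCategoryᵒᵖ) :
    cotKer n X j ≤ (cotKer n Y j).comap (f.app j).hom := by
  refine Subgroup.normalClosure_le_normal ?_
  rintro _ ⟨k, σ, x, hσ, hx, rfl⟩
  refine Subgroup.subset_normalClosure ⟨k, σ, f.app _ x, hσ, killed_app f hx, ?_⟩
  exact (ConcreteCategory.congr_hom (f.naturality σ.op) x).symm

end Cot

/-- The cotruncation functor `Cot_n` on simplicial groups: in the semidirect decomposition of each
`X_j` into copies of the terms of the Moore complex `M`, the copies of `M_k` with `k > n` are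
killed and `M_n` is replaced by `M_n / δ_{n+1}(M_{n+1})`. -/
def Cot (n : ℕ) : SimplicialObject GrpCat.{u} ⥤ SimplicialObject GrpCat.{u} where
  obj X :=
    { obj := fun j => GrpCat.of (X.obj j ⧸ cotKer n X j)
      map := fun θ => GrpCat.ofHom (QuotientGroup.map _ _ (X.map θ).hom (cotKer_map θ))
      map_id := fun j => by
        ext x
        change ((X.map (𝟙 j) x : X.obj j) : X.obj j ⧸ cotKer n X j) = _
        rw [X.map_id]
        rfl
      map_comp := fun {i j k} θ φ => by
        ext x
        change ((X.map (θ ≫ φ) x : X.obj k) : X.obj k ⧸ cotKer n X k) = _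
        rw [X.map_comp]
        rfl }
  map {X Y} f :=
    { app := fun j => GrpCat.ofHom (QuotientGroup.map _ _ (f.app j).hom (cotKer_app f j))
      naturality := fun i j θ => by
        ext x
        exact congrArg (QuotientGroup.mk (s := cotKer n Y j))
          (ConcreteCategory.congr_hom (f.naturality θ) x) }
  map_id X := by
    ext j x
    rfl
  map_comp f g := by
    ext j x
    rfl

/-- The natural projection `η_X : X ⟶ Cot_n(X)`. -/
def η (n : ℕ) : 𝟭 (SimplicialObject GrpCat.{u}) ⟶ Cot n where
  app X :=
    { app := fun j => GrpCat.ofHom (QuotientGroup.mk' (cotKer n X j))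
      naturality := fun _ _ _ => rfl }
  naturality _ _ _ := rfl

/-- `Ker(Cot_n)`: the simplicial groups `X` with `Cot_n(X) ≅ 0`. -/
def kerCot (n : ℕ) : ObjectProperty (SimplicialObject GrpCat.{u}) :=
  fun X => IsZero ((Cot n).obj X)

/-- `M_{n≥}`: the simplicial groups whose Moore complex is trivial in degrees `> n`. -/
def mooreLE (n : ℕ) : ObjectProperty (SimplicialObject GrpCat.{u}) :=
  fun X => ∀ i : ℤ, (n : ℤ) < i → IsZero ((N.obj X).X i)

/-- The sequence `0 ⟶ ker(η_X) ⟶ X ⟶ Cot_n(X) ⟶ 0`. -/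
def muSeq (n : ℕ) (X : SimplicialObject GrpCat.{u}) : ShortComplex (SimplicialObject GrpCat.{u}) :=
  ShortComplex.mk (kernel.ι ((η n).app X)) ((η n).app X) (kernel.condition _)

end SimpGrp

end

/-! Write M = N(X). Everything rests on one computation: inside the Moore complex, the kernel of `η`
is exactly the removed part, `cotKer` ∩ M_k = `killed` (`mem_cotKer_iff_of_mem_moore`). Above degree
n the removed part is all of M_k. In degree k ≤ n, a generator coming from a proper degeneracy
starts in degree below n, where nothing is removed; only the identity of [k] contributes, and the
boundaries are already normal in X_k.

The semidirect decomposition itself is never used. Two consequences replace it: a degreewise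
surjection stays surjective on Moore complexes (`exists_mem_moore_of_surjective`), and a simplicial
group with trivial Moore complex is trivial (`eq_one_of_moore_eq_bot`). They show that Cot_n(X) has
no Moore terms above n, that Cot_n kills ker(η), and that N carries the sequence of X to a short
exact one.

Maps from Ker(Cot_n) to M_{n≥} vanish because `cotKer` is functorial, is everything on the source
and is trivial on the target. Finally, two short exact sequences with the same middle term are
isomorphic once the cross composites vanish, which identifies the image under N with `cokSeq`. -/

section Torsion

variable {C : Type*} [Category C] [HasZeroMorphisms C]

/-- Two short exact sequences with the same middle term are isomorphic over it as soon as each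
inclusion composes to zero with the other projection. -/
theorem IsShortExactSeq.exists_iso {A B Q A' Q' : C} {f : A ⟶ B} {g : B ⟶ Q} {w : f ≫ g = 0}
    {f' : A' ⟶ B} {g' : B ⟶ Q'} {w' : f' ≫ g' = 0}
    (h : IsShortExactSeq (ShortComplex.mk f g w)) (h' : IsShortExactSeq (ShortComplex.mk f' g' w'))
    (h₁ : f ≫ g' = 0) (h₂ : f' ≫ g = 0) :
    ∃ e : ShortComplex.mk f g w ≅ ShortComplex.mk f' g' w', e.hom.τ₂ = 𝟙 B := by
  obtain ⟨⟨hk⟩, ⟨hc⟩⟩ := h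
  obtain ⟨⟨hk'⟩, ⟨hc'⟩⟩ := h'
  dsimp only at hk hc hk' hc'
  obtain ⟨a, ha⟩ := KernelFork.IsLimit.lift' hk' f h₁
  obtain ⟨b, hb⟩ := KernelFork.IsLimit.lift' hk f' h₂
  obtain ⟨c, hc₁⟩ := CokernelCofork.IsColimit.desc' hc g' h₁
  obtain ⟨d, hd⟩ := CokernelCofork.IsColimit.desc' hc' g h₂
  change a ≫ f' = f at ha
  change b ≫ f = f' at hb
  change g ≫ c = g' at hc₁
  change g' ≫ d = g at hd
  have eA : a ≫ b = 𝟙 A := Fork.IsLimit.hom_ext hk <| by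
    change (a ≫ b) ≫ f = 𝟙 A ≫ f
    rw [Category.assoc, hb, ha, Category.id_comp]
  have eA' : b ≫ a = 𝟙 A' := Fork.IsLimit.hom_ext hk' <| by
    change (b ≫ a) ≫ f' = 𝟙 A' ≫ f'
    rw [Category.assoc, ha, hb, Category.id_comp]
  have eQ : c ≫ d = 𝟙 Q := Cofork.IsColimit.hom_ext hc <| by
    change g ≫ c ≫ d = g ≫ 𝟙 Q
    rw [← Category.assoc, hc₁, hd, Category.comp_id]
  have eQ' : d ≫ c = 𝟙 Q' := Cofork.IsColimit.hom_ext hc' <| by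
    change g' ≫ d ≫ c = g' ≫ 𝟙 Q'
    rw [← Category.assoc, hd, hc₁, Category.comp_id]
  exact ⟨ShortComplex.isoMk ⟨a, b, eA, eA'⟩ (Iso.refl B) ⟨c, d, eQ, eQ'⟩
    (by simpa using ha) (by simpa using hc₁.symm), rfl⟩

/-- The inclusion in a short exact sequence can be replaced by the chosen kernel. -/
theorem IsShortExactSeq.kernel {A B Q : C} {f : A ⟶ B} {g : B ⟶ Q} {w : f ≫ g = 0} [HasKernel g]
    (h : IsShortExactSeq (ShortComplex.mk f g w)) :
    IsShortExactSeq (ShortComplex.mk (kernel.ι g) g (kernel.condition g)) := by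
  obtain ⟨-, ⟨hc⟩⟩ := h
  dsimp only at hc
  -- `f` factors through `kernel.ι g`, so a map killed by `kernel.ι g` is killed by `f` and descends
  -- along `g`.
  have key : ∀ {Z : C} (k : B ⟶ Z), kernel.ι g ≫ k = 0 → f ≫ k = 0 := fun k hk => by
    rw [← kernel.lift_ι g f w, Category.assoc, hk, comp_zero]
  exact ⟨⟨kernelIsKernel g⟩, ⟨CokernelCofork.IsColimit.ofπ g (kernel.condition g)
    (fun k hk => (CokernelCofork.IsColimit.desc' hc k (key k hk)).1)
    (fun k hk => (CokernelCofork.IsColimit.desc' hc k (key k hk)).2)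
    fun k hk m hm => Cofork.IsColimit.hom_ext hc
      (hm.trans (CokernelCofork.IsColimit.desc' hc k (key k hk)).2.symm)⟩⟩

theorem IsShortExactSeq.of_iso {S S' : ShortComplex C} (h : IsShortExactSeq S) (e : S ≅ S') :
    IsShortExactSeq S' := by
  obtain ⟨⟨hk⟩, ⟨hc⟩⟩ := h
  have : Mono S.f := mono_of_isLimit_fork hk
  have : Epi S.g := epi_of_isColimit_cofork hc
  have hf : S'.f = e.inv.τ₁ ≫ S.f ≫ e.hom.τ₂ := by
    rw [← e.hom.comm₁₂, ← Category.assoc, ← ShortComplex.comp_τ₁, e.inv_hom_id,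
      ShortComplex.id_τ₁, Category.id_comp]
  have hg : S'.g = e.inv.τ₂ ≫ S.g ≫ e.hom.τ₃ := by
    rw [← e.hom.comm₂₃, ← Category.assoc, ← ShortComplex.comp_τ₂, e.inv_hom_id,
      ShortComplex.id_τ₂, Category.id_comp]
  have : Mono S'.f := by
    rw [hf]
    infer_instance
  have : Epi S'.g := by
    rw [hg]
    infer_instance
  constructor
  · refine ⟨KernelFork.IsLimit.ofι' _ _ fun k hw => ?_⟩
    have hw' : (k ≫ e.inv.τ₂) ≫ S.g = 0 := by
      rw [Category.assoc, e.inv.comm₂₃, ← Category.assoc, hw, zero_comp]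
    obtain ⟨l, hl⟩ := KernelFork.IsLimit.lift' hk _ hw'
    refine ⟨l ≫ e.hom.τ₁, ?_⟩
    change l ≫ S.f = _ at hl
    rw [Category.assoc, e.hom.comm₁₂, ← Category.assoc, hl, Category.assoc,
      ← ShortComplex.comp_τ₂, e.inv_hom_id, ShortComplex.id_τ₂, Category.comp_id]
  · refine ⟨CokernelCofork.IsColimit.ofπ' _ _ fun k hw => ?_⟩
    have hw' : S.f ≫ e.hom.τ₂ ≫ k = 0 := by
      rw [← Category.assoc, ← e.hom.comm₁₂, Category.assoc, hw, comp_zero]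
    obtain ⟨l, hl⟩ := CokernelCofork.IsColimit.desc' hc _ hw'
    refine ⟨e.inv.τ₃ ≫ l, ?_⟩
    change S.g ≫ l = _ at hl
    rw [← Category.assoc, ← e.inv.comm₂₃, Category.assoc, hl, ← Category.assoc,
      ← ShortComplex.comp_τ₂, e.inv_hom_id, ShortComplex.id_τ₂, Category.id_comp]

theorem IsTorsionTheory.isTorsionSeq_of_iso {P T F : ObjectProperty C} (h : IsTorsionTheory P T F)
    {S S' : ShortComplex C} (hS : IsTorsionSeq T F S) (e : S ≅ S') :
    IsTorsionSeq T F S' :=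
  have := h.replete_torsion
  have := h.replete_torsionFree
  ⟨hS.shortExact.of_iso e, T.prop_of_iso (ShortComplex.π₁.mapIso e) hS.torsion,
    F.prop_of_iso (ShortComplex.π₃.mapIso e) hS.torsionFree⟩

end Torsion

/-! ### Kernels, cokernels and normal epimorphisms of groups, and degreewise exactness. -/

namespace GrpCat

variable {A B C : GrpCat.{u}} {f : A ⟶ B} {g : B ⟶ C} (w : f ≫ g = 0)

/-- An injective homomorphism whose image contains the kernel of `g` is a kernel of `g`. -/
theorem nonempty_isLimit_kernelFork (hf : Function.Injective f)
    (h : ∀ b, g b = 1 → b ∈ f.hom.range) : Nonempty (IsLimit (KernelFork.ofι f w)) := by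
  have : Mono f := (GrpCat.mono_iff_injective f).2 hf
  let e : A ≃* f.hom.range := MonoidHom.ofInjective hf
  refine ⟨KernelFork.IsLimit.ofι' f w fun {Z} k hk => ⟨GrpCat.ofHom (e.symm.toMonoidHom.comp
    (k.hom.codRestrict f.hom.range fun z => h _ (ConcreteCategory.congr_hom hk z))), ?_⟩⟩
  ext z
  exact MonoidHom.apply_ofInjective_symm hf _

/-- A surjective homomorphism whose kernel is contained in the image of `f` is a cokernel of
`f`. -/
theorem nonempty_isColimit_cokernelCofork (hg : Function.Surjective g)
    (h : ∀ b, g b = 1 → b ∈ f.hom.range) :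
    Nonempty (IsColimit (CokernelCofork.ofπ g w)) := by
  have : Epi g := (GrpCat.epi_iff_surjective g).2 hg
  refine ⟨CokernelCofork.IsColimit.ofπ' g w fun {Z} k hk => ⟨GrpCat.ofHom
    (g.hom.liftOfSurjective hg ⟨k.hom, ?_⟩), ?_⟩⟩
  · intro b hb
    obtain ⟨a, rfl⟩ := h b hb
    exact ConcreteCategory.congr_hom hk a
  · ext b
    exact MonoidHom.liftOfRightInverse_comp_apply _ _ (Function.rightInverse_surjInv hg) _ _

/-- A cokernel is epi, and epimorphisms of groups are surjective; conversely a surjection is the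
cokernel of the inclusion of its kernel. -/
theorem nonempty_normalEpi_iff (g : B ⟶ C) :
    Nonempty (NormalEpi g) ↔ Function.Surjective g := by
  constructor
  · rintro ⟨h⟩
    rw [← GrpCat.epi_iff_surjective]
    exact ⟨fun a b hab => Cofork.IsColimit.hom_ext h.isColimit hab⟩
  · intro hg
    have w : GrpCat.ofHom g.hom.ker.subtype ≫ g = 0 := by
      ext x
      exact x.2
    obtain ⟨hc⟩ := nonempty_isColimit_cokernelCofork w hg fun b hb => ⟨⟨b, hb⟩, rfl⟩
    exact ⟨⟨_, _, w, hc⟩⟩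

theorem isZero_iff_forall_eq_one (G : GrpCat.{u}) : IsZero G ↔ ∀ x : G, x = 1 := by
  constructor
  · intro h x
    exact ConcreteCategory.congr_hom (h.eq_of_src (𝟙 G) 0) x
  · intro h
    have : Subsingleton G := ⟨fun a b => (h a).trans (h b).symm⟩
    exact isZero_of_subsingleton G

end GrpCat

/-- A degreewise short exact sequence of chain complexes of groups is short exact. -/
theorem GrpChain.isShortExactSeq {S : ShortComplex (ChainComplex GrpCat.{u} ℤ)}
    (hf : ∀ i, Function.Injective (S.f.f i)) (hg : ∀ i, Function.Surjective (S.g.f i))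
    (h : ∀ i b, S.g.f i b = 1 → b ∈ (S.f.f i).hom.range) : IsShortExactSeq S where
  isKernel := ⟨HomologicalComplex.isLimitOfEval _ _ fun i =>
    (KernelFork.isLimitMapConeEquiv _ (HomologicalComplex.eval _ _ i)).2
      (GrpCat.nonempty_isLimit_kernelFork (HomologicalComplex.congr_hom S.zero i)
        (hf i) (h i)).some⟩
  isCokernel := ⟨HomologicalComplex.isColimitOfEval _ _ fun i =>
    (CokernelCofork.isColimitMapCoconeEquiv _ (HomologicalComplex.eval _ _ i)).2
      (GrpCat.nonempty_isColimit_cokernelCofork (HomologicalComplex.congr_hom S.zero i)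
        (hg i) (h i)).some⟩

/-- A degreewise short exact sequence of simplicial groups is short exact. -/
theorem SimpGrp.isShortExactSeq {S : ShortComplex (SimplicialObject GrpCat.{u})}
    (hf : ∀ j, Function.Injective (S.f.app j)) (hg : ∀ j, Function.Surjective (S.g.app j))
    (h : ∀ j b, S.g.app j b = 1 → b ∈ (S.f.app j).hom.range) : IsShortExactSeq S where
  isKernel := ⟨evaluationJointlyReflectsLimits _ fun j =>
    (KernelFork.isLimitMapConeEquiv _ ((evaluation SimplexCategoryᵒᵖ GrpCat.{u}).obj j)).2
      (GrpCat.nonempty_isLimit_kernelFork (NatTrans.congr_app S.zero j) (hf j) (h j)).some⟩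
  isCokernel := ⟨evaluationJointlyReflectsColimits _ fun j =>
    (CokernelCofork.isColimitMapCoconeEquiv _
      ((evaluation SimplexCategoryᵒᵖ GrpCat.{u}).obj j)).2
      (GrpCat.nonempty_isColimit_cokernelCofork (NatTrans.congr_app S.zero j)
        (hg j) (h j)).some⟩

/-! ### The torsion theory COK_m on proper chain complexes. -/

namespace GrpChain

theorem hom_f_d_apply {M M' : ChainComplex GrpCat.{u} ℤ} (f : M ⟶ M') (i j : ℤ) (x : M.X i) :
    M'.d i j (f.f i x) = f.f j (M.d i j x) :=
  ConcreteCategory.congr_hom (f.comm i j) x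

theorem iso_hom_inv_apply {M M' : ChainComplex GrpCat.{u} ℤ} (e : M ≅ M') (i : ℤ) (x : M'.X i) :
    e.hom.f i (e.inv.f i x) = x :=
  ConcreteCategory.congr_hom (HomologicalComplex.congr_hom e.inv_hom_id i) x

/-- A degreewise surjective chain map sends proper complexes to proper complexes. -/
theorem proper_of_surjective {M M' : ChainComplex GrpCat.{u} ℤ} (f : M ⟶ M')
    (hf : ∀ i, Function.Surjective (f.f i)) (hM : proper M) : proper M' := by
  intro i j
  have h : (M'.d i j).hom.range = (M.d i j).hom.range.map (f.f j).hom := by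
    ext y
    constructor
    · rintro ⟨x, rfl⟩
      obtain ⟨x, rfl⟩ := hf i x
      exact ⟨_, ⟨x, rfl⟩, (hom_f_d_apply f i j x).symm⟩
    · rintro ⟨_, ⟨x, rfl⟩, rfl⟩
      exact ⟨f.f i x, hom_f_d_apply f i j x⟩
  rw [h]
  exact (hM i j).map _ (hf j)

theorem surjective_iso_hom {M M' : ChainComplex GrpCat.{u} ℤ} (e : M ≅ M') (i : ℤ) :
    Function.Surjective (e.hom.f i) :=
  fun x => ⟨_, iso_hom_inv_apply e i x⟩

instance : proper.{u}.IsClosedUnderIsomorphisms where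
  of_iso e h := proper_of_surjective e.hom (surjective_iso_hom e) h

theorem isZero_X_of_iso {M M' : ChainComplex GrpCat.{u} ℤ} (e : M ≅ M') {i : ℤ}
    (h : IsZero (M.X i)) : IsZero (M'.X i) :=
  h.of_iso ((HomologicalComplex.eval _ _ i).mapIso e.symm)

instance (n : ℤ) : (properLE.{u} n).IsClosedUnderIsomorphisms where
  of_iso e h := ⟨proper.prop_of_iso e h.1, fun i hi => isZero_X_of_iso e (h.2 i hi)⟩

instance (m : ℤ) : (EP.{u} m).IsClosedUnderIsomorphisms where
  of_iso {M M'} e h := by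
    refine ⟨proper.prop_of_iso e h.1, ?_, fun i hi => isZero_X_of_iso e (h.2.2 i hi)⟩
    have hd := (GrpCat.nonempty_normalEpi_iff _).1 h.2.1
    refine (GrpCat.nonempty_normalEpi_iff _).2 fun y => ?_
    obtain ⟨y, rfl⟩ := surjective_iso_hom e _ y
    obtain ⟨x, rfl⟩ := hd y
    exact ⟨e.hom.f m x, hom_f_d_apply e.hom _ _ x⟩

/-- Only in degree m - 1 can both complexes be nonzero. There every element of A is a boundary from
A_m, and its image is a boundary from B_m = 0. -/
theorem hom_eq_zero_of_EP_of_properLE {m : ℤ} {A B : ChainComplex GrpCat.{u} ℤ} (hA : EP m A)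
    (hB : properLE (m - 1) B) (f : A ⟶ B) : f = 0 := by
  ext i x
  change f.f i x = 1
  rcases lt_trichotomy i (m - 1) with hi | rfl | hi
  · rw [(GrpCat.isZero_iff_forall_eq_one _).1 (hA.2.2 i hi) x, map_one]
  · obtain ⟨x, rfl⟩ := (GrpCat.nonempty_normalEpi_iff _).1 hA.2.1 x
    rw [← hom_f_d_apply, (GrpCat.isZero_iff_forall_eq_one _).1 (hB.2 m (by omega)) (f.f m x),
      map_one]
  · exact (GrpCat.isZero_iff_forall_eq_one _).1 (hB.2 i hi) _

variable {M : ChainComplex GrpCat.{u} ℤ}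

/-- Properness enters here: it makes the normal closure in `cot` equal to `cokSubgroup`. -/
theorem normal_cokSubgroup (hM : proper M) (m : ℤ) (i : ℤ) : (cokSubgroup M m i).Normal := by
  unfold cokSubgroup
  split_ifs
  · infer_instance
  · exact hM m i

theorem cokπ_f_eq_one_iff (hM : proper M) (m : ℤ) (i : ℤ) (x : M.X i) :
    (cokπ M m).f i x = 1 ↔ x ∈ cokSubgroup M m i := by
  have := normal_cokSubgroup hM m i
  rw [← Subgroup.normalClosure_eq_self (cokSubgroup M m i)]
  exact QuotientGroup.eq_one_iff x

theorem isShortExactSeq_cokSeq (hM : proper M) (m : ℤ) : IsShortExactSeq (cokSeq M m) :=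
  isShortExactSeq (fun _ => Subtype.val_injective) (fun _ => QuotientGroup.mk_surjective)
    fun i b hb => ⟨⟨b, (cokπ_f_eq_one_iff hM m i b).1 hb⟩, rfl⟩

/-- From degree m upwards nothing was removed from the source, so the image is that of M pulled back
to the subgroup; below m the elements are boundaries and the differential vanishes. -/
theorem proper_cokSub (hM : proper M) (m : ℤ) : proper (cokSub M m) := by
  intro i j
  by_cases hi : m ≤ i
  · have h : ((cokSub M m).d i j).hom.range =
        (M.d i j).hom.range.comap (cokSubgroup M m j).subtype := by
      ext y
      constructor
      · rintro ⟨x, rfl⟩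
        exact ⟨x.1, rfl⟩
      · rintro ⟨x, hx⟩
        have hx' : x ∈ cokSubgroup M m i := by
          rw [cokSubgroup, if_pos hi]
          trivial
        exact ⟨⟨x, hx'⟩, Subtype.ext hx⟩
    rw [h]
    exact (hM i j).comap _
  · have h : ((cokSub M m).d i j).hom.range = ⊥ := by
      rw [eq_bot_iff]
      rintro _ ⟨⟨x, hx⟩, rfl⟩
      rw [cokSubgroup, if_neg hi] at hx
      obtain ⟨z, rfl⟩ := hx
      exact Subtype.ext (d_d_apply M m i j z)
    rw [h]
    infer_instance

theorem EP_cokSub (hM : proper M) (m : ℤ) : EP m (cokSub M m) := by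
  refine ⟨proper_cokSub hM m, (GrpCat.nonempty_normalEpi_iff _).2 ?_, fun i hi => ?_⟩
  · rintro ⟨y, hy⟩
    have hy' := hy
    rw [cokSubgroup, if_neg (by omega)] at hy'
    obtain ⟨x, hx⟩ := hy'
    have hx' : x ∈ cokSubgroup M m m := by
      rw [cokSubgroup, if_pos le_rfl]
      trivial
    exact ⟨⟨x, hx'⟩, Subtype.ext hx⟩
  · refine (GrpCat.isZero_iff_forall_eq_one _).2 ?_
    rintro ⟨y, hy⟩
    have hy' := hy
    -- Degrees m and i < m - 1 are not adjacent, so `M.d m i` is zero.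
    rw [cokSubgroup, if_neg (by omega), M.shape m i (show ¬i + 1 = m by omega)] at hy'
    obtain ⟨x, hx⟩ := hy'
    exact Subtype.ext hx.symm

theorem properLE_cot (hM : proper M) (m : ℤ) : properLE (m - 1) (cot M m) := by
  refine ⟨proper_of_surjective (cokπ M m) (fun _ => QuotientGroup.mk_surjective) hM,
    fun i hi => (GrpCat.isZero_iff_forall_eq_one _).2 fun y => ?_⟩
  obtain ⟨x, rfl⟩ := QuotientGroup.mk_surjective y
  refine (cokπ_f_eq_one_iff hM m i x).2 ?_
  rw [cokSubgroup, if_pos (by omega)]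
  trivial

theorem isTorsionSeq_cokSeq (hM : proper M) (m : ℤ) :
    IsTorsionSeq (EP m) (properLE (m - 1)) (cokSeq M m) :=
  ⟨isShortExactSeq_cokSeq hM m, EP_cokSub hM m, properLE_cot hM m⟩

theorem isTorsionTheory_EP_properLE (m : ℤ) :
    IsTorsionTheory proper.{u} (EP m) (properLE (m - 1)) where
  torsion_le _ h := h.1
  torsionFree_le _ h := h.1
  replete_torsion := inferInstance
  replete_torsionFree := inferInstance
  hom_eq_zero _ _ hA hB f := hom_eq_zero_of_EP_of_properLE hA hB f
  exists_seq M hM := ⟨cokSeq M m, rfl, isTorsionSeq_cokSeq hM m⟩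

end GrpChain

namespace SimpGrp

/-! ### Exactness of the Moore normalization -/

section Moore

variable {X Y : SimplicialObject GrpCat.{u}}

/-- The boundaries of the Moore complex form a normal subgroup of the simplicial group. -/
theorem normal_map_δ_last_moore (X : SimplicialObject GrpCat.{u}) (k : ℕ) :
    ((moore X (k + 1)).map (X.δ (Fin.last (k + 1))).hom).Normal := by
  refine ⟨?_⟩
  rintro _ ⟨y, hy, rfl⟩ g
  -- Conjugation by s_k(g): its last face is g, and the other faces of y are trivial, hence so are
  -- those of the conjugate.
  refine ⟨X.σ (Fin.last k) g * y * (X.σ (Fin.last k) g)⁻¹, ?_, ?_⟩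
  · refine (mem_moore_succ X).2 fun i => ?_
    rw [map_mul, map_mul, (mem_moore_succ X).1 hy i, mul_one, ← map_mul, mul_inv_cancel, map_one]
  · have h : X.δ (Fin.last (k + 1)) (X.σ (Fin.last k) g) = g :=
      ConcreteCategory.congr_hom (X.δ_comp_σ_succ (i := Fin.last k)) g
    change X.δ (Fin.last (k + 1)) _ = _ * X.δ (Fin.last (k + 1)) y * _
    rw [map_mul, map_mul, map_inv, h]

/-- A degreewise surjective map of simplicial groups is surjective on Moore complexes. -/
theorem exists_mem_moore_of_surjective (f : X ⟶ Y) (hf : ∀ j, Function.Surjective (f.app j))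
    {k : ℕ} {y : Y.obj (op (.mk k))} (hy : y ∈ moore Y k) : ∃ x ∈ moore X k, f.app _ x = y := by
  cases k with
  | zero =>
    obtain ⟨x, rfl⟩ := hf _ y
    exact ⟨x, trivial, rfl⟩
  | succ k =>
    rw [mem_moore_succ] at hy
    -- An arbitrary lift is corrected one face at a time; after stage m the faces d_i with i < m are
    -- trivial.
    suffices h : ∀ m : ℕ, ∃ x : X.obj (op (.mk (k + 1))), f.app _ x = y ∧
        ∀ i : Fin (k + 1), i.val < m → X.δ i.castSucc x = 1 by
      obtain ⟨x, hx, h⟩ := h (k + 1)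
      exact ⟨x, (mem_moore_succ X).2 fun i => h i i.2, hx⟩
    intro m
    induction m with
    | zero =>
      obtain ⟨x, hx⟩ := hf _ y
      exact ⟨x, hx, fun i hi => absurd hi (Nat.not_lt_zero _)⟩
    | succ m ih =>
      obtain ⟨x, hx, h⟩ := ih
      by_cases hm : m < k + 1
      · let i : Fin (k + 1) := ⟨m, hm⟩
        -- Since d_i s_i = id, this factor cancels d_i(x). It maps to 1 in Y because d_i(y) = 1, and
        -- for j < i its face d_j is trivial because d_j s_i d_i = s_{i-1} d_{i-1} d_j.
        refine ⟨x * (X.σ i (X.δ i.castSucc x))⁻¹, ?_, fun j hj => ?_⟩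
        · have h₁ : f.app _ (X.σ i (X.δ i.castSucc x)) = Y.σ i (f.app _ (X.δ i.castSucc x)) :=
            ConcreteCategory.congr_hom (SimplicialObject.σ_naturality f i) _
          rw [map_mul, map_inv, h₁, ← δ_naturality_apply, hx, hy i, map_one, inv_one, mul_one]
        · rcases Nat.lt_succ_iff_lt_or_eq.1 hj with hj | hj
          · have hk : k ≠ 0 := by omega
            obtain ⟨k, rfl⟩ := Nat.exists_eq_succ_of_ne_zero hk
            obtain ⟨i', hi'⟩ : ∃ i' : Fin (k + 1), i = i'.succ :=
              ⟨⟨m - 1, by omega⟩, Fin.ext (by simp [i]; omega)⟩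
            obtain ⟨j', rfl⟩ : ∃ j' : Fin (k + 1), j = j'.castSucc :=
              ⟨⟨j, by omega⟩, rfl⟩
            have hij : j'.castSucc ≤ i'.castSucc := by
              have : i.val = i'.val + 1 := by rw [hi']; rfl
              rw [Fin.le_def]
              simp only [Fin.val_castSucc] at hj ⊢
              simp only [i] at this
              omega
            have h₁ : X.δ j'.castSucc.castSucc (X.σ i (X.δ i.castSucc x)) =
                X.σ i' (X.δ j'.castSucc (X.δ i.castSucc x)) := by
              rw [hi']
              exact ConcreteCategory.congr_hom (X.δ_comp_σ_of_le hij) _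
            have h₂ : X.δ j'.castSucc (X.δ i.castSucc x) =
                X.δ i'.castSucc (X.δ j'.castSucc.castSucc x) := by
              rw [hi', ← Fin.succ_castSucc]
              exact ConcreteCategory.congr_hom (X.δ_comp_δ hij) x
            rw [map_mul, map_inv, h₁, h₂, h _ hj]
            simp only [map_one, inv_one, mul_one]
          · obtain rfl : j = i := Fin.ext hj
            have h₁ : X.δ i.castSucc (X.σ i (X.δ i.castSucc x)) = X.δ i.castSucc x :=
              ConcreteCategory.congr_hom (X.δ_comp_σ_self (i := i)) _
            rw [map_mul, map_inv, h₁, mul_inv_cancel]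
      · exact ⟨x, hx, fun i _ => h i (by omega)⟩

/-- A simplicial group whose Moore complex is trivial is trivial. -/
theorem eq_one_of_moore_eq_bot (h : ∀ k, moore X k = ⊥) (k : ℕ) (x : X.obj (op (.mk k))) :
    x = 1 := by
  induction k with
  | zero =>
    rw [← Subgroup.mem_bot, ← h]
    trivial
  | succ k ih =>
    -- All faces of x are trivial by induction, so x lies in the Moore subgroup.
    rw [← Subgroup.mem_bot, ← h, mem_moore_succ]
    exact fun i => ih _

theorem N_d_apply (X : SimplicialObject GrpCat.{u}) (k : ℕ) (x : moore X (k + 1)) :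
    (N.obj X).d (Int.ofNat k + 1) (Int.ofNat k) x = mooreδ X k x :=
  ConcreteCategory.congr_hom
    (ChainComplex.of_d (mooreX X) (mooreD X) (Int.ofNat k)) x

/-- The boundaries are normal in all of X_k, hence in M_k; the remaining differentials are trivial.
-/
theorem proper_N (X : SimplicialObject GrpCat.{u}) : GrpChain.proper (N.obj X) := by
  intro i j
  by_cases hij : j + 1 = i
  · subst hij
    match j with
    | Int.ofNat k =>
      refine ⟨?_⟩
      rintro _ ⟨x, rfl⟩ g
      obtain ⟨y, hy, h⟩ := (normal_map_δ_last_moore X k).conj_mem _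
        (Subgroup.mem_map_of_mem _ x.2) g.1
      refine ⟨⟨y, hy⟩, ?_⟩
      have h' : mooreδ X k ⟨y, hy⟩ = (show moore X k from g) * mooreδ X k x *
          (show moore X k from g)⁻¹ := Subtype.ext h
      exact (N_d_apply X k ⟨y, hy⟩).trans <| h'.trans <|
        congrArg (fun z : moore X k => (show moore X k from g) * z * (show moore X k from g)⁻¹)
          (N_d_apply X k x).symm
    | Int.negSucc k =>
      refine ⟨fun a ha g => ?_⟩
      convert ha using 1
      exact Subsingleton.elim (α := PUnit) _ _
  · rw [(N.obj X).shape i j hij]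
    have : (GrpCat.Hom.hom (0 : (N.obj X).X i ⟶ (N.obj X).X j)).range = ⊥ := by
      rw [eq_bot_iff]
      rintro _ ⟨x, rfl⟩
      rfl
    rw [this]
    infer_instance

theorem mooreLE_iff {n : ℕ} : mooreLE n X ↔ ∀ k, n < k → moore X k = ⊥ := by
  constructor
  · intro h k hk
    rw [Subgroup.eq_bot_iff_forall]
    intro x hx
    exact congrArg Subtype.val ((GrpCat.isZero_iff_forall_eq_one _).1
      (h (Int.ofNat k) (Int.ofNat_lt.2 hk)) ⟨x, hx⟩)
  · intro h i hi
    rw [GrpCat.isZero_iff_forall_eq_one]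
    match i with
    | Int.ofNat k =>
      rintro ⟨x, hx⟩
      refine Subtype.ext ?_
      rw [h k (Int.ofNat_lt.1 hi)] at hx
      exact hx
    | Int.negSucc k => exact fun x => Subsingleton.elim (α := PUnit) _ _

/-- The dictionary between the chain side, with m = n + 1, and the simplicial side: the cases k > n,
k = n and k < n correspond. -/
theorem mem_cokSubgroup_N_iff {n k : ℕ} (x : moore X k) :
    (show (N.obj X).X (Int.ofNat k) from x) ∈
      GrpChain.cokSubgroup (N.obj X) ((n : ℤ) + 1) (Int.ofNat k) ↔ x.1 ∈ killed n X k := by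
  unfold GrpChain.cokSubgroup killed
  by_cases h₁ : n < k
  · rw [if_pos h₁, if_pos (by simp; omega)]
    exact ⟨fun _ => x.2, fun _ => trivial⟩
  rw [if_neg h₁, if_neg (by simp; omega)]
  by_cases h₂ : k = n
  · subst h₂
    rw [if_pos rfl]
    constructor
    · rintro ⟨y, hy⟩
      exact ⟨_, y.2, congrArg Subtype.val ((N_d_apply X k y).symm.trans hy)⟩
    · rintro ⟨y, hy, h⟩
      exact ⟨⟨y, hy⟩, (N_d_apply X k ⟨y, hy⟩).trans (Subtype.ext h)⟩
  · have hd : (N.obj X).d ((n : ℤ) + 1) (Int.ofNat k) = 0 :=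
      (N.obj X).shape _ _ (show ¬(k : ℤ) + 1 = (n : ℤ) + 1 by omega)
    rw [if_neg h₂, hd]
    constructor
    · rintro ⟨y, hy⟩
      exact (congrArg Subtype.val hy).symm
    · intro h
      exact ⟨1, (Subtype.ext h.symm : (1 : moore X k) = x)⟩

end Moore

/-! ### The torsion theory of the cotruncation -/

section Cot

variable {n : ℕ} {X : SimplicialObject GrpCat.{u}}

theorem killed_le_moore (k : ℕ) : killed n X k ≤ moore X k := by
  unfold killed
  split_ifs
  · exact le_rfl
  · rintro _ ⟨y, hy, rfl⟩
    exact δ_last_mem_moore X hy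
  · exact bot_le

theorem killed_le_cotKer (k : ℕ) : killed n X k ≤ cotKer n X (op (.mk k)) := fun x hx =>
  Subgroup.subset_normalClosure ⟨k, 𝟙 _, x, inferInstance, hx,
    ConcreteCategory.congr_hom (X.map_id _) x⟩

/-- A surjection from [k] has target [l] with l ≤ k ≤ n. If l < k then `killed` is trivial in degree
l, and if l = k the surjection is the identity; what remains is already normal. -/
theorem cotKer_eq_killed_of_le {k : ℕ} (hk : k ≤ n) :
    cotKer n X (op (.mk k)) = killed n X k := by
  refine le_antisymm ?_ (killed_le_cotKer k)
  have : (killed n X k).Normal := by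
    unfold killed
    rw [if_neg (by omega)]
    split_ifs
    · exact normal_map_δ_last_moore X k
    · infer_instance
  refine Subgroup.normalClosure_le_normal ?_
  rintro _ ⟨l, σ, x, hσ, hx, rfl⟩
  have hlk : l ≤ k := SimplexCategory.len_le_of_epi σ
  by_cases hl : l = k
  · subst hl
    rw [SimplexCategory.eq_id_of_epi σ]
    have h : X.map (𝟙 (SimplexCategory.mk l)).op x = x :=
      ConcreteCategory.congr_hom (X.map_id _) x
    rw [h]
    exact hx
  · unfold killed at hx
    rw [if_neg (by omega), if_neg (by omega), Subgroup.mem_bot] at hx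
    rw [hx, map_one]
    exact one_mem _

/-- Above degree n there is nothing to check, since `killed` is then the whole Moore subgroup. -/
theorem mem_cotKer_iff_of_mem_moore {k : ℕ} {x : X.obj (op (.mk k))} (hx : x ∈ moore X k) :
    x ∈ cotKer n X (op (.mk k)) ↔ x ∈ killed n X k := by
  refine ⟨fun h => ?_, fun h => killed_le_cotKer k h⟩
  by_cases hk : k ≤ n
  · rwa [← cotKer_eq_killed_of_le hk]
  · rwa [killed, if_pos (by omega)]

theorem η_app_eq_one_iff {j : SimplexCategoryᵒᵖ} (x : X.obj j) :
    ((η n).app X).app j x = 1 ↔ x ∈ cotKer n X j :=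
  QuotientGroup.eq_one_iff x

theorem η_app_surjective (j : SimplexCategoryᵒᵖ) :
    Function.Surjective (((η n).app X).app j) :=
  QuotientGroup.mk_surjective

/-- A Moore element of the quotient lifts to a Moore element of X, which is killed. -/
theorem moore_Cot_eq_bot {k : ℕ} (h : killed n X k = moore X k) :
    moore ((Cot n).obj X) k = ⊥ := by
  rw [Subgroup.eq_bot_iff_forall]
  intro y hy
  obtain ⟨x, hx, rfl⟩ := exists_mem_moore_of_surjective ((η n).app X) η_app_surjective hy
  exact (η_app_eq_one_iff x).2 (killed_le_cotKer k (h.ge hx))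

theorem mooreLE_Cot : mooreLE n ((Cot n).obj X) :=
  mooreLE_iff.2 fun k hk => moore_Cot_eq_bot (by rw [killed, if_pos hk])

theorem kerCot_of_killed_eq_moore (h : ∀ k, killed n X k = moore X k) : kerCot n X :=
  Functor.isZero _ fun j => (GrpCat.isZero_iff_forall_eq_one _).2 fun x =>
    eq_one_of_moore_eq_bot (fun k => moore_Cot_eq_bot (h k)) j.unop.len x

/-- Here `cotKer` is all of A and is carried into that of B, which is trivial: B has no Moore terms
above n, so no boundaries from degree n + 1 either. -/
theorem hom_eq_zero_of_kerCot_of_mooreLE {A B : SimplicialObject GrpCat.{u}} (hA : kerCot n A)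
    (hB : mooreLE n B) (f : A ⟶ B) : f = 0 := by
  ext j x
  have hx : x ∈ cotKer n A j := (η_app_eq_one_iff x).1 <|
    ConcreteCategory.congr_hom (NatTrans.congr_app (hA.eq_of_tgt ((η n).app A) 0) j) x
  have h : cotKer n B j ≤ ⊥ := by
    refine Subgroup.normalClosure_le_normal ?_
    rintro _ ⟨k, σ, x, -, hx, rfl⟩
    suffices h : killed n B k = ⊥ by
      rw [h, Subgroup.mem_bot] at hx
      rw [hx, map_one]
      exact one_mem _
    unfold killed
    split_ifs with h₁ h₂
    · exact mooreLE_iff.1 hB k h₁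
    · rw [mooreLE_iff.1 hB (k + 1) (by omega), Subgroup.map_bot]
    · rfl
  exact h (cotKer_app f j hx)

instance : (kerCot.{u} n).IsClosedUnderIsomorphisms where
  of_iso e h := IsZero.of_iso h ((Cot n).mapIso e.symm)

instance : (mooreLE.{u} n).IsClosedUnderIsomorphisms where
  of_iso e h i hi := GrpChain.isZero_X_of_iso (N.mapIso e) (h i hi)

/-! ### The kernel of `η` as an explicit simplicial subgroup, and its Moore complex. -/

variable (n X)

/-- The simplicial subgroup of `X` given by the kernels of `X ⟶ Cot_n(X)`. -/
def cotSub : SimplicialObject GrpCat.{u} where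
  obj j := GrpCat.of (cotKer n X j)
  map {i j} θ := GrpCat.ofHom <| ((X.map θ).hom.comp (cotKer n X i).subtype).codRestrict
    (cotKer n X j) fun x => cotKer_map θ x.2
  map_id j := by
    ext x
    exact ConcreteCategory.congr_hom (X.map_id j) x.1
  map_comp θ φ := by
    ext x
    exact ConcreteCategory.congr_hom (X.map_comp θ φ) x.1

/-- The inclusion of `cotSub n X` in `X`. -/
def cotι : cotSub n X ⟶ X where
  app j := GrpCat.ofHom (cotKer n X j).subtype
  naturality _ _ _ := rfl

/-- The sequence `0 ⟶ cotSub n X ⟶ X ⟶ Cot_n(X) ⟶ 0`. -/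
def cotSeq : ShortComplex (SimplicialObject GrpCat.{u}) :=
  ShortComplex.mk (cotι n X) ((η n).app X) <| by
    ext j x
    exact (η_app_eq_one_iff _).2 x.2

variable {n X}

theorem mem_moore_cotSub_iff {k : ℕ} (x : (cotSub n X).obj (op (.mk k))) :
    x ∈ moore (cotSub n X) k ↔ (cotι n X).app _ x ∈ moore X k := by
  cases k with
  | zero => exact Iff.rfl
  | succ k =>
    rw [mem_moore_succ, mem_moore_succ]
    exact forall_congr' fun i => Subtype.ext_iff

theorem kerCot_cotSub : kerCot n (cotSub n X) := by
  refine kerCot_of_killed_eq_moore fun k => le_antisymm (killed_le_moore k) fun x hx => ?_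
  have hx' := (mem_cotKer_iff_of_mem_moore ((mem_moore_cotSub_iff x).1 hx)).1 x.2
  unfold killed at hx' ⊢
  split_ifs at hx' ⊢ with h₁ h₂
  · exact hx
  · obtain ⟨y, hy, hyx⟩ := hx'
    -- A boundary in degree n must bound inside the subobject; it does, because all of M_{n+1} is
    -- removed.
    have hy' : y ∈ cotKer n X (op (.mk (k + 1))) :=
      (mem_cotKer_iff_of_mem_moore hy).2 (by rwa [killed, if_pos (by omega)])
    exact ⟨⟨y, hy'⟩, (mem_moore_cotSub_iff (n := n) ⟨y, hy'⟩).2 hy, Subtype.ext hyx⟩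
  · exact Subtype.ext hx'

theorem isShortExactSeq_cotSeq : IsShortExactSeq (cotSeq n X) :=
  isShortExactSeq (fun _ => Subtype.val_injective) η_app_surjective
    fun _ b hb => ⟨⟨b, (η_app_eq_one_iff b).1 hb⟩, rfl⟩

theorem isTorsionSeq_cotSeq : IsTorsionSeq (kerCot n) (mooreLE n) (cotSeq n X) :=
  ⟨isShortExactSeq_cotSeq, kerCot_cotSub, mooreLE_Cot⟩

variable (n) in
theorem isTorsionTheory_kerCot_mooreLE :
    IsTorsionTheory ⊤ (kerCot.{u} n) (mooreLE.{u} n) where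
  torsion_le := le_top
  torsionFree_le := le_top
  replete_torsion := inferInstance
  replete_torsionFree := inferInstance
  hom_eq_zero _ _ hA hB f := hom_eq_zero_of_kerCot_of_mooreLE hA hB f
  exists_seq X _ := ⟨cotSeq n X, rfl, isTorsionSeq_cotSeq⟩

/-- Moore elements of the subobject are the Moore elements of X lying in it, which gives the kernel;
surjectivity is the lifting lemma. -/
theorem isShortExactSeq_N_cotSeq : IsShortExactSeq ((cotSeq n X).map N) := by
  refine GrpChain.isShortExactSeq (fun i => ?_) (fun i => ?_) (fun i b hb => ?_)
  · match i with
    | Int.ofNat k =>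
      exact fun x y h => Subtype.ext
        (Subtype.ext (congrArg (fun z : moore X k => z.1) h))
    | Int.negSucc k => exact fun x y _ => Subsingleton.elim (α := PUnit) x y
  · match i with
    | Int.ofNat k =>
      rintro ⟨y, hy⟩
      obtain ⟨x, hx, h⟩ := exists_mem_moore_of_surjective ((η n).app X) η_app_surjective hy
      exact ⟨⟨x, hx⟩, Subtype.ext h⟩
    | Int.negSucc k => exact fun y => ⟨1, Subsingleton.elim (α := PUnit) _ _⟩
  · match i with
    | Int.ofNat k =>
      obtain ⟨b, hb'⟩ := b
      have h : b ∈ cotKer n X (op (.mk k)) := (η_app_eq_one_iff b).1 (congrArg Subtype.val hb)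
      exact ⟨⟨⟨b, h⟩, (mem_moore_cotSub_iff (n := n) ⟨b, h⟩).2 hb'⟩, rfl⟩
    | Int.negSucc k => exact ⟨1, Subsingleton.elim (α := PUnit) _ _⟩

/-! ### Transfer to the categorical kernel and comparison with COK_{n+1}. -/

variable (n X)

theorem isShortExactSeq_muSeq : IsShortExactSeq (muSeq n X) :=
  (isShortExactSeq_cotSeq (n := n) (X := X)).kernel

theorem exists_iso_cotSeq : ∃ e : muSeq n X ≅ cotSeq n X, e.hom.τ₂ = 𝟙 X :=
  (isShortExactSeq_muSeq n X).exists_iso isShortExactSeq_cotSeq (kernel.condition _)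
    (cotSeq n X).zero

theorem isTorsionSeq_muSeq : IsTorsionSeq (kerCot n) (mooreLE n) (muSeq n X) := by
  obtain ⟨e, -⟩ := exists_iso_cotSeq n X
  exact (isTorsionTheory_kerCot_mooreLE n).isTorsionSeq_of_iso isTorsionSeq_cotSeq e.symm

theorem exists_iso_N_cotSeq :
    ∃ e : (cotSeq n X).map N ≅ GrpChain.cokSeq (N.obj X) ((n : ℤ) + 1),
      e.hom.τ₂ = 𝟙 (N.obj X) := by
  -- Only the two cross composites need checking; both vanish because `cotKer`, `killed` and
  -- `cokSubgroup` agree on M.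
  refine isShortExactSeq_N_cotSeq.exists_iso
    (GrpChain.isShortExactSeq_cokSeq (proper_N X) ((n : ℤ) + 1)) ?_ ?_
  · ext i x
    refine (GrpChain.cokπ_f_eq_one_iff (proper_N X) _ i _).2 ?_
    match i with
    | Int.ofNat k =>
      obtain ⟨x, hx⟩ := x
      have hx' := (mem_moore_cotSub_iff x).1 hx
      exact (mem_cokSubgroup_N_iff ⟨_, hx'⟩).2 ((mem_cotKer_iff_of_mem_moore hx').1 x.2)
    | Int.negSucc k =>
      have h : ∀ z : (N.obj X).X (Int.negSucc k),
          z ∈ GrpChain.cokSubgroup (N.obj X) ((n : ℤ) + 1) (Int.negSucc k) := fun z => by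
        rw [show z = 1 from Subsingleton.elim (α := PUnit) _ _]
        exact one_mem _
      exact h _
  · ext i x
    match i with
    | Int.ofNat k =>
      exact Subtype.ext ((η_app_eq_one_iff _).2
        (killed_le_cotKer k ((mem_cokSubgroup_N_iff (n := n) x.1).1 x.2)))
    | Int.negSucc k => exact Subsingleton.elim (α := PUnit) _ _

theorem exists_iso_N_muSeq :
    ∃ e : (muSeq n X).map N ≅ GrpChain.cokSeq (N.obj X) ((n : ℤ) + 1),
      e.hom.τ₂ = 𝟙 (N.obj X) := by
  obtain ⟨e, he⟩ := exists_iso_cotSeq n X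
  obtain ⟨e', he'⟩ := exists_iso_N_cotSeq n X
  refine ⟨N.mapShortComplex.mapIso e ≪≫ e', ?_⟩
  change N.map e.hom.τ₂ ≫ e'.hom.τ₂ = _
  rw [he, he']
  exact (Category.comp_id _).trans (N.map_id X)

variable {n X}

/-- If Cot_n(X) = 0 then `η` is zero and its kernel is X itself, so N(X) is isomorphic to the
torsion part `cokSub`. -/
theorem EP_N_of_kerCot (h : kerCot n X) : GrpChain.EP ((n : ℤ) + 1) (N.obj X) := by
  have hη : (η n).app X = 0 := h.eq_of_tgt _ _
  have : IsIso (muSeq n X).f := kernel.ι_of_zero hη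
  obtain ⟨e, -⟩ := exists_iso_N_muSeq n X
  exact (GrpChain.EP _).prop_of_iso
    (ShortComplex.π₁.mapIso e.symm ≪≫ N.mapIso (@asIso _ _ _ _ (muSeq n X).f this))
    (GrpChain.EP_cokSub (proper_N X) _)

end Cot

end SimpGrp

theorem mainTheorem9 (n : ℕ) :
    IsTorsionTheory ⊤ (SimpGrp.kerCot.{u} n) (SimpGrp.mooreLE.{u} n) ∧
    IsTorsionTheory GrpChain.proper (GrpChain.EP.{u} ((n : ℤ) + 1)) (GrpChain.properLE.{u} (n : ℤ)) ∧
    (∀ X : SimplicialObject GrpCat.{u},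
      IsTorsionSeq (SimpGrp.kerCot n) (SimpGrp.mooreLE n) (SimpGrp.muSeq n X) ∧
      GrpChain.proper (SimpGrp.N.obj X) ∧
      IsTorsionSeq (GrpChain.EP ((n : ℤ) + 1)) (GrpChain.properLE (n : ℤ))
        (GrpChain.cokSeq (SimpGrp.N.obj X) ((n : ℤ) + 1)) ∧
      IsTorsionSeq (GrpChain.EP ((n : ℤ) + 1)) (GrpChain.properLE (n : ℤ))
        ((SimpGrp.muSeq n X).map SimpGrp.N) ∧
      ∃ e : (SimpGrp.muSeq n X).map SimpGrp.N ≅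
          GrpChain.cokSeq (SimpGrp.N.obj X) ((n : ℤ) + 1),
        e.hom.τ₂ = 𝟙 (SimpGrp.N.obj X)) ∧
    (∀ X : SimplicialObject GrpCat.{u},
      SimpGrp.kerCot n X → GrpChain.EP ((n : ℤ) + 1) (SimpGrp.N.obj X)) ∧
    (∀ X : SimplicialObject GrpCat.{u},
      SimpGrp.mooreLE n X → GrpChain.properLE (n : ℤ) (SimpGrp.N.obj X)) := by
  have hcok := GrpChain.isTorsionTheory_EP_properLE.{u} ((n : ℤ) + 1)
  rw [add_sub_cancel_right] at hcok
  refine ⟨SimpGrp.isTorsionTheory_kerCot_mooreLE n, hcok, fun X => ?_,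
    fun X => SimpGrp.EP_N_of_kerCot, fun X h => ⟨SimpGrp.proper_N X, h⟩⟩
  have hseq := GrpChain.isTorsionSeq_cokSeq (SimpGrp.proper_N X) ((n : ℤ) + 1)
  rw [add_sub_cancel_right] at hseq
  obtain ⟨e, he⟩ := SimpGrp.exists_iso_N_muSeq n X
  exact ⟨SimpGrp.isTorsionSeq_muSeq n X, SimpGrp.proper_N X, hseq,
    hcok.isTorsionSeq_of_iso hseq e.symm, e, he⟩
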